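/- Let $X=(X_t)_{t\ge 0}$ be a subordinator, i.e. a real-valued process starting at $0$ with stationary independent increments and almost surely non-decreasing paths. Suppose that it has drift $d>0$, meaning that for some measure $\Pi$ on $(0,\infty)$ with $\int_0^\infty (1\wedge x)\,\Pi(dx)<\infty$ one has $$\mathbb{E}\big[e^{-\lambda X_1}\big]=\exp\Big(-d\lambda-\int_0^\infty(1-e^{-\lambda x})\,\Pi(dx)\Big)\qquad\text{for all }\lambda\ge 0.$$ For $A\subset\mathbb{R}^n$ let $N(A,\delta)$ be the minimal number of closed axis-parallel boxes of side length $\delta$ needed to cover $A$; the box-counting dimension of $A$ is $\lim_{\delta\downarrow 0}\log N(A,\delta)/\log(1/\delta)$. Then, almost surely, for every $t>0$ the box-counting dimensions of the range $\{X_s:0\le s\le t\}\subset\mathbb{R}$ and of the graph $\{(s,X_s):0\le s\le t\}\subset\mathbb{R}^2$ exist (as finite limits) and are equal. -/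

import Mathlib

open MeasureTheory ProbabilityTheory Filter Topology
open scoped NNReal ENNReal

noncomputable section

/-- A subordinator: a real-valued process indexed by `[0, ∞)` that starts at the origin, has
independent and stationary increments, and has non-decreasing paths almost surely.
Right-continuity of the paths is not required, so that every càdlàg subordinator is included. -/
structure IsSubordinator {Ω : Type*} [MeasurableSpace Ω] (X : ℝ≥0 → Ω → ℝ) (P : Measure Ω) :
    Prop where
  measurable : ∀ t, Measurable (X t)
  start : ∀ᵐ ω ∂P, X 0 ω = 0
  indep : HasIndepIncrements X P
  stationary : ∀ s t : ℝ≥0, IdentDistrib (fun ω => X (s + t) ω - X s ω) (X t) P P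
  mono : ∀ᵐ ω ∂P, Monotone fun t => X t ω

/-- `X` has linear drift `d` and Lévy measure `ν`: here `d ≥ 0`, `ν` is a measure on `(0, ∞)` with
`∫ min(1, x) ν(dx) < ∞`, and `E[exp(-l X₁)] = exp(-Φ(l))` for all `l ≥ 0`, with the Laplace exponent
`Φ(l) = d l + ∫_{(0, ∞)} (1 - exp(-l x)) ν(dx)`. -/
structure HasDriftAndLevyMeasure {Ω : Type*} [MeasurableSpace Ω] (X : ℝ≥0 → Ω → ℝ)
    (P : Measure Ω) (d : ℝ) (ν : Measure ℝ) : Prop where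
  drift_nonneg : 0 ≤ d
  support : ν (Set.Iic 0) = 0
  integrability : ∫⁻ x, ENNReal.ofReal (min 1 x) ∂ν < ∞
  laplace : ∀ l : ℝ, 0 ≤ l →
    ∫ ω, Real.exp (-(l * X 1 ω)) ∂P =
      Real.exp (-(d * l + ∫ x in Set.Ioi (0 : ℝ), (1 - Real.exp (-(l * x))) ∂ν))

/-- The closed axis-parallel box of side length `δ` with lowest corner `a` in `ℝⁿ`. -/
def box {n : ℕ} (a : Fin n → ℝ) (δ : ℝ) : Set (Fin n → ℝ) :=
  {x | ∀ i, a i ≤ x i ∧ x i ≤ a i + δ}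

/-- The minimal number of boxes of side length `δ` needed to cover `S` (`⊤` if no finite number
of boxes suffices). -/
def boxCount {n : ℕ} (S : Set (Fin n → ℝ)) (δ : ℝ) : ℕ∞ :=
  ⨅ (C : Finset (Fin n → ℝ)) (_ : S ⊆ ⋃ a ∈ C, box a δ), (C.card : ℕ∞)

/-- `S` has box-counting dimension `D`: the limit of `log N(δ) / log (1 / δ)` as `δ` decreases to
`0` exists in the extended reals and equals `D`. -/
def HasBoxDim {n : ℕ} (S : Set (Fin n → ℝ)) (D : EReal) : Prop :=
  Tendsto (fun δ : ℝ => ENNReal.log (boxCount S δ : ℝ≥0∞) / ((Real.log (1 / δ) : ℝ) : EReal))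
    (𝓝[>] 0) (𝓝 D)

/-- The range `{f s : 0 ≤ s ≤ t}` of a path `f`, as a subset of `ℝ¹`. -/
def pathRange (f : ℝ≥0 → ℝ) (t : ℝ≥0) : Set (Fin 1 → ℝ) :=
  {x | ∃ s ≤ t, x = ![f s]}

/-- The graph `{(s, f s) : 0 ≤ s ≤ t}` of a path `f`, as a subset of `ℝ²`. -/
def pathGraph (f : ℝ≥0 → ℝ) (t : ℝ≥0) : Set (Fin 2 → ℝ) :=
  {x | ∃ s ≤ t, x = ![(s : ℝ), f s]}

end

/-! Both dimensions equal 1, since both box counts lie between `c / δ` and `C / δ`. Jumps only add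
to the drift, so almost surely every increment is at least `d` times the elapsed time; a box of side
`δ` then absorbs time at most `δ / d`, which bounds the range count below (`le_boxCount_pathRange`).
Monotonicity bounds the graph count above (`boxCount_pathGraph_le`), and the range is a projection
of the graph. The increment bound comes from the Laplace transform
(`IsSubordinator.ae_drift_mul_le`). -/

/-! ### Box counting for deterministic paths. -/

lemma hasBoxDim_one_of_bounds {n : ℕ} {S : Set (Fin n → ℝ)} {c C : ℝ} (hc : 0 < c) (hC : 0 < C)
    (hlow : ∀ δ : ℝ, 0 < δ → δ < 1 → ENNReal.ofReal (c / δ) ≤ (boxCount S δ : ℝ≥0∞))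
    (hup : ∀ δ : ℝ, 0 < δ → δ < 1 → (boxCount S δ : ℝ≥0∞) ≤ ENNReal.ofReal (C / δ)) :
    HasBoxDim S ((1 : ℝ) : EReal) := by
  have key : ∀ a : ℝ, 0 < a → Tendsto
      (fun δ : ℝ => ((Real.log (a / δ) / Real.log (1 / δ) : ℝ) : EReal)) (𝓝[>] 0)
      (𝓝 ((1 : ℝ) : EReal)) := by
    intro a ha
    rw [EReal.tendsto_coe]
    have hlog : Tendsto (fun δ : ℝ => Real.log (1 / δ)) (𝓝[>] 0) atTop := by
      simp only [one_div]
      exact Real.tendsto_log_atTop.comp tendsto_inv_nhdsGT_zero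
    have h1 : Tendsto (fun δ : ℝ => Real.log a / Real.log (1 / δ) + 1) (𝓝[>] 0) (𝓝 1) := by
      simpa using (hlog.const_div_atTop (Real.log a)).add_const 1
    refine h1.congr' ?_
    filter_upwards [hlog.eventually_gt_atTop 0, self_mem_nhdsWithin] with δ hδ hδ0
    have hδ0 : 0 < δ := hδ0
    rw [div_eq_mul_one_div a δ, Real.log_mul ha.ne' (by positivity), add_div, div_self hδ.ne']
  have hsmall : ∀ᶠ δ : ℝ in 𝓝[>] 0, 0 < δ ∧ δ < 1 :=
    Ioo_mem_nhdsGT (by norm_num : (0 : ℝ) < 1)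
  refine tendsto_of_tendsto_of_tendsto_of_le_of_le' (key c hc) (key C hC) ?_ ?_
  · filter_upwards [hsmall] with δ ⟨h0, h1⟩
    have hl : 0 ≤ Real.log (1 / δ) := Real.log_nonneg (by rw [le_div_iff₀ h0]; linarith)
    rw [EReal.coe_div, ← ENNReal.log_ofReal_of_pos (x := c / δ) (by positivity)]
    exact EReal.div_le_div_right_of_nonneg (by exact_mod_cast hl)
      (ENNReal.log_le_log (hlow δ h0 h1))
  · filter_upwards [hsmall] with δ ⟨h0, h1⟩
    have hl : 0 ≤ Real.log (1 / δ) := Real.log_nonneg (by rw [le_div_iff₀ h0]; linarith)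
    rw [EReal.coe_div, ← ENNReal.log_ofReal_of_pos (x := C / δ) (by positivity)]
    exact EReal.div_le_div_right_of_nonneg (by exact_mod_cast hl)
      (ENNReal.log_le_log (hup δ h0 h1))

/-- A set that is cut into `m` pieces, each of width at most `δ` in every coordinate, is covered
by `m` boxes of side length `δ`. -/
lemma boxCount_le_of_index {n : ℕ} {S : Set (Fin n → ℝ)} {δ : ℝ} (m : ℕ)
    (k : (Fin n → ℝ) → ℕ) (hk : ∀ x ∈ S, k x < m)
    (hd : ∀ x ∈ S, ∀ y ∈ S, k x = k y → ∀ i, x i ≤ y i + δ) :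
    boxCount S δ ≤ m := by
  classical
  -- Coordinatewise infimum of each piece; an empty piece gets a junk corner, which does no harm.
  let corner : ℕ → Fin n → ℝ := fun j i => sInf ((fun x => x i) '' {x ∈ S | k x = j})
  have hcov : S ⊆ ⋃ a ∈ (Finset.range m).image corner, box a δ := by
    intro x hx
    simp only [Finset.mem_image, Finset.mem_range, Set.mem_iUnion, exists_prop]
    refine ⟨corner (k x), ⟨k x, hk x hx, rfl⟩, fun i => ⟨?_, ?_⟩⟩
    · refine csInf_le ⟨x i - δ, ?_⟩ ⟨x, ⟨hx, rfl⟩, rfl⟩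
      rintro _ ⟨y, ⟨hy, hyk⟩, rfl⟩
      have := hd x hx y hy hyk.symm i
      simp only
      linarith
    · rw [← sub_le_iff_le_add]
      refine le_csInf ⟨_, x, ⟨hx, rfl⟩, rfl⟩ ?_
      rintro _ ⟨y, ⟨hy, hyk⟩, rfl⟩
      have := hd x hx y hy hyk.symm i
      simp only
      linarith
  refine (iInf₂_le (f := fun (D : Finset (Fin _ → ℝ)) (_ : _ ⊆ ⋃ a ∈ D, box a δ) =>
    (D.card : ℕ∞)) _ hcov).trans ?_
  exact_mod_cast Finset.card_image_le.trans (Finset.card_range m).le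

lemma boxCount_pathRange_le_pathGraph (f : ℝ≥0 → ℝ) (t : ℝ≥0) (δ : ℝ) :
    boxCount (pathRange f t) δ ≤ boxCount (pathGraph f t) δ := by
  classical
  refine le_iInf₂ fun C hC => ?_
  have hcov : pathRange f t ⊆ ⋃ a ∈ C.image (fun a => ![a 1]), box a δ := by
    rintro _ ⟨s, hs, rfl⟩
    have := hC ⟨s, hs, rfl⟩
    simp only [Set.mem_iUnion, exists_prop] at this
    obtain ⟨a, ha, hbox⟩ := this
    simp only [Set.mem_iUnion, exists_prop]
    refine ⟨_, Finset.mem_image_of_mem _ ha, fun i => ?_⟩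
    fin_cases i
    simpa using hbox 1
  refine (iInf₂_le (f := fun (D : Finset (Fin _ → ℝ)) (_ : _ ⊆ ⋃ a ∈ D, box a δ) =>
    (D.card : ℕ∞)) _ hcov).trans ?_
  exact_mod_cast Finset.card_image_le

/-- Both coordinates of the graph increase together, so a change of at most `δ` in `s + f s` bounds
the change in each; the graph is cut along the levels of this sum. -/
lemma boxCount_pathGraph_le {f : ℝ≥0 → ℝ} (hf : Monotone f) (t : ℝ≥0) {δ : ℝ}
    (h0 : 0 < δ) (h1 : δ < 1) :
    (boxCount (pathGraph f t) δ : ℝ≥0∞) ≤ ENNReal.ofReal ((t + (f t - f 0) + 1) / δ) := by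
  have hft : 0 ≤ f t - f 0 := sub_nonneg.2 (hf zero_le)
  have ht : (0 : ℝ) ≤ t := t.2
  have hle : boxCount (pathGraph f t) δ ≤ (⌊(t + (f t - f 0)) / δ⌋₊ + 1 : ℕ) := by
    refine boxCount_le_of_index _ (fun x => ⌊(x 0 + (x 1 - f 0)) / δ⌋₊) ?_ ?_
    · rintro _ ⟨s, hs, rfl⟩
      have hs' : (s : ℝ) ≤ t := hs
      have := hf hs
      refine Nat.lt_succ_of_le (Nat.floor_le_floor ?_)
      simp only [Matrix.cons_val_zero, Matrix.cons_val_one]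
      gcongr
    · rintro _ ⟨s, hs, rfl⟩ _ ⟨r, hr, rfl⟩ hk
      simp only [Matrix.cons_val_zero, Matrix.cons_val_one] at hk
      have hsum : (s : ℝ) + f s ≤ r + f r + δ := by
        have hr0 : 0 ≤ ((r : ℝ) + (f r - f 0)) / δ :=
          div_nonneg (add_nonneg r.2 (sub_nonneg.2 (hf zero_le))) h0.le
        have a1 := Nat.lt_floor_add_one (((s : ℝ) + (f s - f 0)) / δ)
        have a2 := Nat.floor_le hr0
        rw [hk] at a1
        have a3 : ((s : ℝ) + (f s - f 0)) / δ < ((r : ℝ) + (f r - f 0)) / δ + 1 := by linarith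
        rw [div_add_one h0.ne', div_lt_div_iff_of_pos_right h0] at a3
        linarith
      have hmono : ((s : ℝ) ≤ r ∧ f s ≤ f r) ∨ ((r : ℝ) ≤ s ∧ f r ≤ f s) :=
        (le_total s r).imp (fun h => ⟨h, hf h⟩) (fun h => ⟨h, hf h⟩)
      rw [Fin.forall_fin_two]
      simp only [Matrix.cons_val_zero, Matrix.cons_val_one]
      rcases hmono with h | h <;> constructor <;> linarith [h.1, h.2]
  have hle' : (boxCount (pathGraph f t) δ : ℝ≥0∞) ≤
      ((⌊(t + (f t - f 0)) / δ⌋₊ + 1 : ℕ) : ℝ≥0∞) := by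
    exact_mod_cast ENat.toENNReal_le.2 hle
  refine hle'.trans ?_
  rw [← ENNReal.ofReal_natCast]
  refine ENNReal.ofReal_le_ofReal ?_
  push_cast
  have b1 := Nat.floor_le (div_nonneg (add_nonneg ht hft) h0.le)
  -- The extra box from the floor is absorbed by the `+ 1` in the constant.
  have b2 : 1 ≤ 1 / δ := by rw [le_div_iff₀ h0]; linarith
  rw [add_div _ 1 δ]
  linarith

/-- A path whose increments are at least `d` times those of the time spends a time of at most
`δ / d` in each box of side length `δ`. -/
lemma le_boxCount_pathRange {f : ℝ≥0 → ℝ} {d : ℝ} (hd : 0 < d)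
    (hf : ∀ s t : ℝ≥0, s ≤ t → d * (t - s) ≤ f t - f s) (t : ℝ≥0) {δ : ℝ} (h0 : 0 < δ) :
    ENNReal.ofReal (d * t / δ) ≤ (boxCount (pathRange f t) δ : ℝ≥0∞) := by
  have hnat : ((⌈d * t / δ⌉₊ : ℕ) : ℕ∞) ≤ boxCount (pathRange f t) δ := by
    refine le_iInf₂ fun C hC => ?_
    rw [Nat.cast_le, Nat.ceil_le]
    let A : (Fin 1 → ℝ) → Set ℝ := fun a => {s | 0 ≤ s ∧ ![f s.toNNReal] ∈ box a δ}
    have hcov : Set.Icc (0 : ℝ) t ⊆ ⋃ a ∈ C, A a := by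
      intro s hs
      have := hC ⟨s.toNNReal, Real.toNNReal_le_iff_le_coe.2 hs.2, rfl⟩
      simp only [Set.mem_iUnion, exists_prop] at this ⊢
      obtain ⟨a, ha, hbox⟩ := this
      exact ⟨a, ha, hs.1, hbox⟩
    have hle : ∀ a, ∀ s ∈ A a, ∀ r ∈ A a, s ≤ r → r - s ≤ δ / d := by
      rintro a s ⟨hs, hsb⟩ r ⟨hr, hrb⟩ hsr
      have h1 := hf _ _ (Real.toNNReal_le_toNNReal hsr)
      rw [Real.coe_toNNReal _ hs, Real.coe_toNNReal _ hr] at h1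
      have h2 := (hsb 0).1
      have h3 := (hrb 0).2
      simp only [Matrix.cons_val_fin_one] at h2 h3
      rw [le_div_iff₀ hd]
      linarith
    -- Outer measure suffices here: `A a` need not be shown measurable.
    have hvol : ∀ a, volume (A a) ≤ ENNReal.ofReal (δ / d) := by
      intro a
      refine (Real.volume_le_diam _).trans (Metric.ediam_le fun s hs r hr => ?_)
      rw [edist_dist]
      refine ENNReal.ofReal_le_ofReal ?_
      rw [Real.dist_eq, abs_le']
      rcases le_total s r with h | h
      · have := hle a s hs r hr h
        constructor <;> linarith
      · have := hle a r hr s hs h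
        constructor <;> linarith
    have hsum : ENNReal.ofReal t ≤ ENNReal.ofReal (C.card * (δ / d)) :=
      calc ENNReal.ofReal t = volume (Set.Icc (0 : ℝ) t) := by simp
        _ ≤ volume (⋃ a ∈ C, A a) := measure_mono hcov
        _ ≤ ∑ a ∈ C, volume (A a) := measure_biUnion_finset_le _ _
        _ ≤ ∑ _a ∈ C, ENNReal.ofReal (δ / d) := Finset.sum_le_sum fun a _ => hvol a
        _ = ENNReal.ofReal (C.card * (δ / d)) := by
            rw [Finset.sum_const, nsmul_eq_mul, ENNReal.ofReal_mul (by positivity),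
              ENNReal.ofReal_natCast]
    have hreal := (ENNReal.ofReal_le_ofReal_iff (by positivity)).1 hsum
    rw [div_le_iff₀ h0]
    rw [← mul_div_assoc, le_div_iff₀ hd] at hreal
    linarith
  have hcast : ((⌈d * t / δ⌉₊ : ℕ) : ℝ≥0∞) ≤ (boxCount (pathRange f t) δ : ℝ≥0∞) := by
    exact_mod_cast ENat.toENNReal_le.2 hnat
  refine le_trans ?_ hcast
  rw [← ENNReal.ofReal_natCast]
  exact ENNReal.ofReal_le_ofReal (Nat.le_ceil _)

/-! ### The drift as an almost sure lower bound on increments. -/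

section Subordinator

variable {Ω : Type*} [MeasurableSpace Ω] {P : Measure Ω} {X : ℝ≥0 → Ω → ℝ}

lemma IsSubordinator.ae_nonneg (hX : IsSubordinator X P) (t : ℝ≥0) : ∀ᵐ ω ∂P, 0 ≤ X t ω := by
  filter_upwards [hX.start, hX.mono] with ω h0 hm
  have := hm (zero_le : 0 ≤ t)
  simp only at this
  linarith

/-- Telescoping into `n` i.i.d. increments; taking `n`-th roots carries the Laplace bound from time
`1` to time `1 / n`. -/
lemma IsSubordinator.mgf_one_eq_pow [IsProbabilityMeasure P] (hX : IsSubordinator X P) {n : ℕ}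
    (hn : n ≠ 0) (u : ℝ) : mgf (X 1) P u = mgf (X (n : ℝ≥0)⁻¹) P u ^ n := by
  let τ : ℕ → ℝ≥0 := fun k => k * (n : ℝ≥0)⁻¹
  have hτ : Monotone τ := fun a b h => by simp only [τ]; gcongr
  have hind := hX.indep.nat hτ
  have hmeas : ∀ k, Measurable (X (τ (k + 1)) - X (τ k)) := fun k =>
    (hX.measurable _).sub (hX.measurable _)
  have hmgf : mgf (∑ k ∈ Finset.range n, (X (τ (k + 1)) - X (τ k))) P u =
      ∏ k ∈ Finset.range n, mgf (X (τ (k + 1)) - X (τ k)) P u :=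
    hind.mgf_sum (t := u) hmeas (Finset.range n)
  have heach : ∀ k, mgf (X (τ (k + 1)) - X (τ k)) P u = mgf (X (n : ℝ≥0)⁻¹) P u := by
    intro k
    have hk : τ (k + 1) = τ k + (n : ℝ≥0)⁻¹ := by simp only [τ]; push_cast; ring
    rw [hk]
    exact congrFun (mgf_congr_identDistrib (hX.stationary (τ k) (n : ℝ≥0)⁻¹)) u
  rw [Finset.sum_range_sub (fun k => X (τ k)), Finset.prod_congr rfl (fun k _ => heach k),
    Finset.prod_const, Finset.card_range] at hmgf
  rw [← hmgf]
  refine mgf_congr ?_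
  filter_upwards [hX.start] with ω h0
  simp [τ, h0, hn]

lemma HasDriftAndLevyMeasure.mgf_one_le {d : ℝ} {ν : Measure ℝ}
    (h : HasDriftAndLevyMeasure X P d ν) {l : ℝ} (hl : 0 ≤ l) :
    mgf (X 1) P (-l) ≤ Real.exp (-(d * l)) := by
  have hint : 0 ≤ ∫ x in Set.Ioi (0 : ℝ), (1 - Real.exp (-(l * x))) ∂ν := by
    refine setIntegral_nonneg measurableSet_Ioi fun x hx => ?_
    have : 0 ≤ l * x := mul_nonneg hl (Set.mem_Ioi.1 hx).le
    simpa using this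
  have heq : mgf (X 1) P (-l) = ∫ ω, Real.exp (-(l * X 1 ω)) ∂P := by
    simp only [mgf, neg_mul]
  rw [heq, h.laplace l hl]
  exact Real.exp_le_exp.2 (by linarith)

/-- Chernoff bound: falling short of `d / n` by `ε` has probability at most `exp (-(l * ε))` for
every `l ≥ 0`; let `l → ∞`. -/
lemma IsSubordinator.ae_drift_le_inv [IsProbabilityMeasure P] (hX : IsSubordinator X P)
    {d : ℝ} {ν : Measure ℝ} (h : HasDriftAndLevyMeasure X P d ν) {n : ℕ} (hn : n ≠ 0) :
    ∀ᵐ ω ∂P, d / n ≤ X (n : ℝ≥0)⁻¹ ω := by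
  set Y := X (n : ℝ≥0)⁻¹ with hY
  have hn0 : (n : ℝ) ≠ 0 := Nat.cast_ne_zero.2 hn
  have hmgf : ∀ l : ℝ, 0 ≤ l → mgf Y P (-l) ≤ Real.exp (-(d / n * l)) := by
    intro l hl
    refine le_of_pow_le_pow_left₀ hn (Real.exp_pos _).le ?_
    rw [← hX.mgf_one_eq_pow hn, ← Real.exp_nat_mul]
    refine (h.mgf_one_le hl).trans_eq ?_
    congr 1
    field_simp
  have hint : ∀ l : ℝ, 0 ≤ l → Integrable (fun ω => Real.exp (-l * Y ω)) P := by
    intro l hl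
    refine Integrable.of_bound (C := 1)
      (((hX.measurable _).const_mul _).exp.aestronglyMeasurable) ?_
    filter_upwards [hX.ae_nonneg (n : ℝ≥0)⁻¹] with ω hω
    rw [Real.norm_eq_abs, Real.abs_exp, Real.exp_le_one_iff]
    nlinarith [mul_nonneg hl hω]
  have hlt : ∀ m : ℕ, ∀ᵐ ω ∂P, d / n - 1 / (m + 1 : ℝ) < Y ω := by
    intro m
    have hε : (0 : ℝ) < 1 / (m + 1 : ℝ) := by positivity
    have hbound : ∀ l : ℝ, 0 ≤ l →
        P.real {ω | Y ω ≤ d / n - 1 / (m + 1 : ℝ)} ≤ Real.exp (-(l * (1 / (m + 1 : ℝ)))) := by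
      intro l hl
      refine (measure_le_le_exp_mul_mgf _ (neg_nonpos.2 hl) (hint l hl)).trans ?_
      refine (mul_le_mul_of_nonneg_left (hmgf l hl) (Real.exp_pos _).le).trans_eq ?_
      rw [← Real.exp_add]
      congr 1
      ring
    have hlim : Tendsto (fun l : ℝ => Real.exp (-(l * (1 / (m + 1 : ℝ))))) atTop (𝓝 0) :=
      Real.tendsto_exp_neg_atTop_nhds_zero.comp (tendsto_id.atTop_mul_const hε)
    have hzero : P.real {ω | Y ω ≤ d / n - 1 / (m + 1 : ℝ)} = 0 :=
      le_antisymm (ge_of_tendsto hlim ((eventually_ge_atTop 0).mono hbound)) measureReal_nonneg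
    rw [ae_iff]
    simpa [measureReal_eq_zero_iff] using hzero
  filter_upwards [ae_all_iff.2 hlt] with ω hω
  have hlim : Tendsto (fun m : ℕ => d / n - 1 / (m + 1 : ℝ)) atTop (𝓝 (d / n - 0)) :=
    tendsto_const_nhds.sub tendsto_one_div_add_atTop_nhds_zero_nat
  rw [sub_zero] at hlim
  exact le_of_tendsto' hlim fun m => (hω m).le

/-- Monotonicity stands in for right-continuity in passing from rational mesh points to all times.
-/
lemma drift_mul_le_sub_of_mesh {f : ℝ≥0 → ℝ} (hf : Monotone f) {d : ℝ} (hd : 0 ≤ d)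
    (hmesh : ∀ n k : ℕ, n ≠ 0 →
      d / n ≤ f (k * (n : ℝ≥0)⁻¹ + (n : ℝ≥0)⁻¹) - f (k * (n : ℝ≥0)⁻¹))
    {s t : ℝ≥0} (hst : s ≤ t) : d * (t - s) ≤ f t - f s := by
  have hsteps : ∀ n : ℕ, n ≠ 0 → ∀ k m : ℕ,
      m * (d / n) ≤ f ((k + m : ℕ) * (n : ℝ≥0)⁻¹) - f (k * (n : ℝ≥0)⁻¹) := by
    intro n hn k m
    induction m with
    | zero => simp
    | succ m ih =>
      have h1 := hmesh n (k + m) hn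
      have h2 : ((k + (m + 1) : ℕ) : ℝ≥0) * (n : ℝ≥0)⁻¹
          = ((k + m : ℕ) : ℝ≥0) * (n : ℝ≥0)⁻¹ + (n : ℝ≥0)⁻¹ := by push_cast; ring
      rw [h2]
      push_cast at h1 ih ⊢
      linarith
  have happrox : ∀ n : ℕ, d * (t - s) - 2 * d * (1 / ((n : ℝ) + 1)) ≤ f t - f s := by
    intro n
    have hN : (0 : ℝ) < n + 1 := by positivity
    have hN' : (0 : ℝ≥0) < ((n + 1 : ℕ) : ℝ≥0) := by positivity
    have hfst : f s ≤ f t := hf hst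
    -- Rounding `s` up and `t` down keeps the mesh points inside `[s, t]` and loses at most two
    -- steps, hence the `2 * d`.
    have hk := Nat.le_ceil (s * ((n + 1 : ℕ) : ℝ≥0))
    have hk' := (Nat.ceil_lt_add_one (zero_le : 0 ≤ s * ((n + 1 : ℕ) : ℝ≥0))).le
    have hj := Nat.floor_le (zero_le : 0 ≤ t * ((n + 1 : ℕ) : ℝ≥0))
    have hj' := (Nat.lt_floor_add_one (t * ((n + 1 : ℕ) : ℝ≥0))).le
    set k := ⌈s * ((n + 1 : ℕ) : ℝ≥0)⌉₊
    set j := ⌊t * ((n + 1 : ℕ) : ℝ≥0)⌋₊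
    have e1 : (k : ℝ) ≤ s * (n + 1) + 1 := by exact_mod_cast hk'
    have e2 : (t : ℝ) * (n + 1) ≤ j + 1 := by exact_mod_cast hj'
    have hcast : d * (t - s) - 2 * d * (1 / ((n : ℝ) + 1)) ≤ ((j : ℝ) - k) * (d / (n + 1)) := by
      have : d * (t - s) - 2 * d * (1 / ((n : ℝ) + 1))
          = (t * (n + 1) - s * (n + 1) - 2) * (d / (n + 1)) := by
        field_simp
      rw [this]
      exact mul_le_mul_of_nonneg_right (by linarith) (by positivity)
    rcases le_total k j with hkj | hjk
    · obtain ⟨m, hm⟩ := Nat.exists_eq_add_of_le hkj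
      have h1 := hsteps (n + 1) n.succ_ne_zero k m
      rw [← hm] at h1
      have h2 : f (j * (((n + 1 : ℕ) : ℝ≥0))⁻¹) ≤ f t := hf (by
        rw [← div_eq_mul_inv, div_le_iff₀ hN']; exact hj)
      have h3 : f s ≤ f (k * (((n + 1 : ℕ) : ℝ≥0))⁻¹) := hf (by
        rw [← div_eq_mul_inv, le_div_iff₀ hN']; exact hk)
      have hm' : (j : ℝ) - k = m := by rw [hm]; push_cast; ring
      rw [hm'] at hcast
      push_cast at h1 h2 h3
      linarith
    -- No full mesh step fits, and the lower bound is nonpositive.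
    · have hjk' : (j : ℝ) ≤ k := by exact_mod_cast hjk
      have : ((j : ℝ) - k) * (d / (n + 1)) ≤ 0 :=
        mul_nonpos_of_nonpos_of_nonneg (by linarith) (by positivity)
      linarith
  have hlim : Tendsto (fun n : ℕ => d * (t - s) - 2 * d * (1 / ((n : ℝ) + 1))) atTop
      (𝓝 (d * (t - s) - 2 * d * 0)) :=
    tendsto_const_nhds.sub (tendsto_one_div_add_atTop_nhds_zero_nat.const_mul _)
  rw [mul_zero, sub_zero] at hlim
  exact le_of_tendsto' hlim happrox

lemma IsSubordinator.ae_drift_mul_le [IsProbabilityMeasure P] (hX : IsSubordinator X P)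
    {d : ℝ} {ν : Measure ℝ} (h : HasDriftAndLevyMeasure X P d ν) :
    ∀ᵐ ω ∂P, ∀ s t : ℝ≥0, s ≤ t → d * (t - s) ≤ X t ω - X s ω := by
  have hmesh : ∀ᵐ ω ∂P, ∀ n k : ℕ, n ≠ 0 →
      d / n ≤ X (k * (n : ℝ≥0)⁻¹ + (n : ℝ≥0)⁻¹) ω - X (k * (n : ℝ≥0)⁻¹) ω := by
    refine ae_all_iff.2 fun n => ae_all_iff.2 fun k => ae_all_iff.2 fun hn => ?_
    exact (hX.stationary (k * (n : ℝ≥0)⁻¹) (n : ℝ≥0)⁻¹).symm.ae_snd measurableSet_Ici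
      (hX.ae_drift_le_inv h hn)
  filter_upwards [hmesh, hX.mono] with ω hω hm s t hst
  exact drift_mul_le_sub_of_mesh hm h.drift_nonneg hω hst

end Subordinator

theorem proposition5p3 {Ω : Type*} [MeasurableSpace Ω] (P : Measure Ω) [IsProbabilityMeasure P]
    (X : ℝ≥0 → Ω → ℝ) (hX : IsSubordinator X P)
    (d : ℝ) (ν : Measure ℝ) (hdν : HasDriftAndLevyMeasure X P d ν) (hd : 0 < d) :
    ∀ᵐ ω ∂P, ∀ t : ℝ≥0, 0 < t →
      ∃ D : ℝ, HasBoxDim (pathRange (fun s => X s ω) t) (D : EReal) ∧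
        HasBoxDim (pathGraph (fun s => X s ω) t) (D : EReal) := by
  filter_upwards [hX.ae_drift_mul_le hdν, hX.mono] with ω hdrift hm t ht
  have ht' : (0 : ℝ) < t := ht
  have hinc : 0 ≤ X t ω - X 0 ω := sub_nonneg.2 (hm (zero_le : 0 ≤ t))
  have hle : ∀ δ : ℝ, (boxCount (pathRange (fun s => X s ω) t) δ : ℝ≥0∞) ≤
      boxCount (pathGraph (fun s => X s ω) t) δ := fun δ =>
    ENat.toENNReal_le.2 (boxCount_pathRange_le_pathGraph _ t δ)
  have hC : 0 < (t : ℝ) + (X t ω - X 0 ω) + 1 := by positivity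
  refine ⟨1, hasBoxDim_one_of_bounds (mul_pos hd ht') hC ?_ ?_,
    hasBoxDim_one_of_bounds (mul_pos hd ht') hC ?_ ?_⟩
  · exact fun δ h0 _ => le_boxCount_pathRange hd hdrift t h0
  · exact fun δ h0 h1 => (hle δ).trans (boxCount_pathGraph_le hm t h0 h1)
  · exact fun δ h0 _ => (le_boxCount_pathRange hd hdrift t h0).trans (hle δ)
  · exact fun δ h0 h1 => boxCount_pathGraph_le hm t h0 h1
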